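/- There is an absolute constant $C>0$ such that the following holds. Let $d_1,d_2\ge 1$ and $d\le d_1$, and let $X,\check X\in\mathbb R^{d_1\times d}$ be matrices of full rank $d$. Let $G\in\mathbb R^{d_1\times d_2}$ be a random matrix with i.i.d. zero-mean sub-Gaussian entries of variance $\sigma^2$, and let $K\ge 0$ be a normalized sub-Gaussian parameter of the entries, i.e. $\mathbb E\,e^{tG_{ij}}\le e^{K^2\sigma^2t^2/2}$ for all $t\in\mathbb R$. Let $r\in\mathbb N$ and $\epsilon\in\mathbb R$. Then there is an event of probability at least $1-2e^{-(d_2+d)}$ on which the following holds for all (possibly $G$-dependent) matrices $W,M\in\mathbb R^{d\times d_2}$ with $\operatorname{rank}(M)=r$ and $$\|XW-(\check XM+G)\|_{op}^2\le\epsilon d_1 :$$ the problem $\min_{\operatorname{rank}(Z)\le r}\|XW-\check XZ\|_F$ has a minimizer $Z\in\mathbb R^{d\times d_2}$, and every minimizer $\hat M$ satisfies $$\frac{\|\check XM-\check X\hat M\|_F^2}{d_1d_2}\le C\left(K^2\, r\,\frac{d_2+d}{d_1d_2}\,\sigma^2+\epsilon\right).$$ Here $\|\cdot\|_{op}$ is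 the spectral norm and $\|\cdot\|_F$ the Frobenius norm. -/

import Mathlib

open MeasureTheory ProbabilityTheory
open scoped NNReal

noncomputable section

/-- The operator (spectral) norm of a real matrix, i.e. the norm of the linear map it induces
between Euclidean spaces. -/
def matOpNorm {m n : ℕ} (A : Matrix (Fin m) (Fin n) ℝ) : ℝ :=
  (Matrix.instL2OpNormedAddCommGroup (m := Fin m) (n := Fin n) (𝕜 := ℝ)).norm A

/-- The Frobenius norm of a real matrix. -/
def matFrobNorm {m n : ℕ} (A : Matrix (Fin m) (Fin n) ℝ) : ℝ :=
  (Matrix.frobeniusNormedAddCommGroup (m := Fin m) (n := Fin n) (α := ℝ)).norm A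

/-- `Mhat` minimizes `‖Y - X' Z‖_F` among all matrices `Z` of rank at most `r`. -/
def IsRankConstrainedMinimizer {d₁ d d₂ : ℕ} (r : ℕ) (Y : Matrix (Fin d₁) (Fin d₂) ℝ)
    (X' : Matrix (Fin d₁) (Fin d) ℝ) (Mhat : Matrix (Fin d) (Fin d₂) ℝ) : Prop :=
  Mhat.rank ≤ r ∧ IsMinOn (fun Z => matFrobNorm (Y - X' * Z)) {Z | Z.rank ≤ r} Mhat

/-- `G` is a random matrix with i.i.d. entries of mean zero and variance `σ ^ 2` that are
sub-Gaussian with normalized sub-Gaussian parameter at most `K`: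
`E exp (t * G i j) ≤ exp (K ^ 2 * σ ^ 2 * t ^ 2 / 2)` for all real `t`. -/
structure IsSubgaussianNoise {Ω : Type*} [MeasurableSpace Ω] (μ : Measure Ω) {d₁ d₂ : ℕ}
    (G : Ω → Matrix (Fin d₁) (Fin d₂) ℝ) (σ K : ℝ≥0) : Prop where
  indep : iIndepFun (fun (p : Fin d₁ × Fin d₂) (ω : Ω) => G ω p.1 p.2) μ
  identDistrib : ∀ i j i' j', IdentDistrib (fun ω => G ω i j) (fun ω => G ω i' j') μ μ
  mean_zero : ∀ i j, ∫ ω, G ω i j ∂μ = 0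
  variance_eq : ∀ i j, variance (fun ω => G ω i j) μ = (σ : ℝ) ^ 2
  subgaussian : ∀ i j, HasSubgaussianMGF (fun ω => G ω i j) (K ^ 2 * σ ^ 2) μ

end

/-! Put `D = X' * (Mhat - M)` and `N = X * W - X' * M = G + E`, where `‖E‖_op² ≤ ε d₁`. Comparing
the minimizer with `M` gives `‖D‖_F² ≤ 2⟪N, D⟫`. Since `D` has rank at most `2r` and columns in
`range X'`, trace duality (`sum_mul_le_of_inner_le`) yields `⟪N, D⟫ ≤ s √(2r) ‖D‖_F`, where `s`
bounds `N` compressed to that range; hence `‖D‖_F² ≤ 8 r s²` (`matFrobNorm_sub_sq_le`). The range is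
a fixed `d`-dimensional space, so a net argument (`IsSubgaussianNoise.exists_event_inner_le`) bounds
the compression of `G` by `O(Kσ√(d₂ + d))`, with no `d₁`. The event concerns `G` alone, so `W` and
`M` may depend on `G`. -/

/-! ### Nets and norms -/

open Module in
/-- In a finite-dimensional normed space the closed ball of radius `2` has a `1`-net with at most
`5 ^ dim` elements. -/
theorem exists_finset_net (E : Type*) [NormedAddCommGroup E] [NormedSpace ℝ E]
    [FiniteDimensional ℝ E] :
    ∃ s : Finset E, s.card ≤ 5 ^ finrank ℝ E ∧ (∀ c ∈ s, ‖c‖ ≤ 2) ∧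
      ∀ x : E, ‖x‖ ≤ 2 → ∃ c ∈ s, ‖x - c‖ ≤ 1 := by
  classical
  -- A 1-separated set of maximal cardinality is a net: a point far from all of it could be added.
  let P : ℕ → Prop := fun n => ∃ s : Finset E, s.card = n ∧ (∀ c ∈ s, ‖c‖ ≤ 2) ∧
    ∀ c ∈ s, ∀ d ∈ s, c ≠ d → 1 ≤ ‖c - d‖
  have hbound : ∀ n, P n → n ≤ 5 ^ finrank ℝ E := by
    rintro n ⟨s, rfl, hs, hsep⟩
    exact Besicovitch.card_le_of_separated s hs hsep
  have h0 : P 0 := ⟨∅, by simp⟩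
  obtain ⟨s, hcard, hs, hsep⟩ : P (Nat.findGreatest P (5 ^ finrank ℝ E)) :=
    Nat.findGreatest_spec (Nat.zero_le _) h0
  refine ⟨s, hcard ▸ Nat.findGreatest_le _, hs, fun x hx => ?_⟩
  by_contra! hfar
  have hxs : x ∉ s := fun h => absurd (hfar x h) (by simp)
  have hP : P (s.card + 1) := by
    refine ⟨insert x s, Finset.card_insert_of_notMem hxs, ?_, ?_⟩
    · simpa [hx] using hs
    · intro c hc d hd hcd
      rcases Finset.mem_insert.1 hc with hcx | hcs <;>
        rcases Finset.mem_insert.1 hd with hdx | hds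
      · exact absurd (hcx.trans hdx.symm) hcd
      · rw [hcx]; exact (hfar d hds).le
      · rw [hdx, norm_sub_rev]; exact (hfar c hcs).le
      · exact hsep c hcs d hds hcd
  have := Nat.le_findGreatest (hbound _ hP) hP
  omega

/-- The vector `2w/‖w‖` pairs with `w` to `2‖w‖`, and moving it to a net point loses at most `‖w‖`.
-/
theorem norm_le_of_forall_mem_net {E : Type*} [NormedAddCommGroup E] [InnerProductSpace ℝ E]
    {s : Finset E} (hs : ∀ x : E, ‖x‖ ≤ 2 → ∃ c ∈ s, ‖x - c‖ ≤ 1) {w : E} {t : ℝ}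
    (h : ∀ c ∈ s, inner ℝ c w ≤ t) : ‖w‖ ≤ t := by
  rcases eq_or_ne w 0 with rfl | hw
  · obtain ⟨c, hc, -⟩ := hs 0 (by simp)
    simpa using h c hc
  have hw' : ‖w‖ ≠ 0 := norm_ne_zero_iff.2 hw
  obtain ⟨c, hc, hxc⟩ := hs ((2 / ‖w‖) • w) (by
    rw [norm_smul, norm_div, norm_norm, div_mul_cancel₀ _ hw']; simp)
  have h1 : inner ℝ ((2 / ‖w‖) • w) w = 2 * ‖w‖ := by
    rw [real_inner_smul_left, real_inner_self_eq_norm_sq]; field_simp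
  have h2 : inner ℝ ((2 / ‖w‖) • w) w = inner ℝ c w + inner ℝ ((2 / ‖w‖) • w - c) w := by
    rw [← inner_add_left]; simp
  have h3 := real_inner_le_norm ((2 / ‖w‖) • w - c) w
  have h4 := mul_le_mul_of_nonneg_right hxc (norm_nonneg w)
  linarith [h c hc]

theorem opNorm_le_of_forall_mem_net {E F : Type*} [NormedAddCommGroup E] [InnerProductSpace ℝ E]
    [NormedAddCommGroup F] [NormedSpace ℝ F] {s : Finset E} {s' : Finset F}
    (hs : ∀ x : E, ‖x‖ ≤ 2 → ∃ c ∈ s, ‖x - c‖ ≤ 1)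
    (hs' : ∀ x : F, ‖x‖ ≤ 2 → ∃ c ∈ s', ‖x - c‖ ≤ 1) (T : F →L[ℝ] E) {t : ℝ} (ht : 0 ≤ t)
    (h : ∀ c ∈ s, ∀ c' ∈ s', inner ℝ c (T c') ≤ t) : ‖T‖ ≤ t := by
  have key : ‖T‖ ≤ (t + ‖T‖) / 2 := by
    refine T.opNorm_le_bound (by positivity) fun v => ?_
    rcases eq_or_ne v 0 with rfl | hv
    · simp
    have hv' : 0 < ‖v‖ := norm_pos_iff.2 hv
    obtain ⟨c, hc, hxc⟩ := hs' ((2 / ‖v‖) • v) (by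
      rw [norm_smul, norm_div, norm_norm, div_mul_cancel₀ _ hv'.ne']; simp)
    have h1 : T ((2 / ‖v‖) • v) = T c + T ((2 / ‖v‖) • v - c) := by rw [← map_add]; simp
    have h2 : ‖T ((2 / ‖v‖) • v)‖ ≤ t + ‖T‖ := by
      rw [h1]
      refine (norm_add_le _ _).trans (add_le_add
        (norm_le_of_forall_mem_net hs fun d hd => h d hd c hc) ?_)
      exact (T.le_opNorm _).trans (mul_le_of_le_one_right (norm_nonneg _) hxc)
    rw [map_smul, norm_smul, norm_div, norm_norm, Real.norm_ofNat] at h2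
    rw [div_mul_eq_mul_div, div_le_iff₀ hv'] at h2
    linarith
  linarith

/-! ### Concentration of the compressed noise -/

theorem ProbabilityTheory.HasSubgaussianMGF.mono {Ω : Type*} {mΩ : MeasurableSpace Ω}
    {μ : Measure Ω} {Z : Ω → ℝ} {c c' : ℝ≥0} (h : HasSubgaussianMGF Z c μ) (hc : c ≤ c') :
    HasSubgaussianMGF Z c' μ where
  integrable_exp_mul := h.integrable_exp_mul
  mgf_le t := (h.mgf_le t).trans (by gcongr)

/-- A sub-Gaussian upper tail bound which is also correct for parameter zero. -/
theorem measureReal_lt_le_exp_of_hasSubgaussianMGF {Ω : Type*} {mΩ : MeasurableSpace Ω}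
    {μ : Measure Ω} [IsProbabilityMeasure μ] {Z : Ω → ℝ} {c : ℝ≥0} (h : HasSubgaussianMGF Z c μ)
    {t a : ℝ} (ht : 0 ≤ t) (hta : 2 * c * a ≤ t ^ 2) :
    μ.real {ω | t < Z ω} ≤ Real.exp (-a) := by
  -- For `c = 0` the Chernoff exponent divides by zero, but `Z = 0` a.s. and the strict event `t <
  -- Z` is null even at `t = 0`.
  rcases eq_or_ne c 0 with rfl | hc
  · have h0 := h.ae_eq_zero_of_hasSubgaussianMGF_zero
    have : μ {ω | t < Z ω} = 0 := by
      refine measure_mono_null (fun ω hω => ?_) h0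
      intro h'
      simp only [Set.mem_ofPred_eq] at hω
      rw [h'] at hω
      exact absurd hω (not_lt.2 ht)
    rw [measureReal_def, this]
    simpa using (Real.exp_pos _).le
  · have hc' : (0 : ℝ) < c := by positivity
    refine (measureReal_mono fun ω (hω : t < Z ω) => hω.le).trans ((h.measure_ge_le ht).trans ?_)
    rw [Real.exp_le_exp, neg_div, neg_le_neg_iff, le_div_iff₀ (by positivity)]
    linarith

theorem inner_toEuclideanLin {m n : ℕ} (A : Matrix (Fin m) (Fin n) ℝ) (u : EuclideanSpace ℝ (Fin m))
    (v : EuclideanSpace ℝ (Fin n)) :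
    inner ℝ u (A.toEuclideanLin v) = ∑ i, ∑ j, u i * v j * A i j := by
  rw [PiLp.inner_apply]
  simp only [Matrix.ofLp_toLpLin, Matrix.toLin'_apply, Matrix.mulVec, dotProduct, RCLike.inner_apply,
    conj_trivial, Finset.sum_mul]
  exact Finset.sum_congr rfl fun i _ => Finset.sum_congr rfl fun j _ => by ring

theorem IsSubgaussianNoise.hasSubgaussianMGF_inner {Ω : Type*} [MeasurableSpace Ω] {μ : Measure Ω}
    {m n : ℕ} {G : Ω → Matrix (Fin m) (Fin n) ℝ} {σ K : ℝ≥0} (hG : IsSubgaussianNoise μ G σ K)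
    {u : EuclideanSpace ℝ (Fin m)} {v : EuclideanSpace ℝ (Fin n)} (hu : ‖u‖ ≤ 2) (hv : ‖v‖ ≤ 2) :
    HasSubgaussianMGF (fun ω => inner ℝ u ((G ω).toEuclideanLin v)) (16 * (K ^ 2 * σ ^ 2)) μ := by
  have hind : iIndepFun (fun (p : Fin m × Fin n) (ω : Ω) => u p.1 * v p.2 * G ω p.1 p.2) μ :=
    hG.indep.comp (fun p x => u p.1 * v p.2 * x) fun p => by fun_prop
  have hsum := HasSubgaussianMGF.sum_of_iIndepFun hind (s := Finset.univ) fun p _ =>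
    (hG.subgaussian p.1 p.2).const_mul (u p.1 * v p.2)
  simp_rw [inner_toEuclideanLin, ← Fintype.sum_prod_type']
  refine hsum.mono ?_
  rw [← NNReal.coe_le_coe, NNReal.coe_sum]
  change ∑ p : Fin m × Fin n, (u p.1 * v p.2) ^ 2 * ((K ^ 2 * σ ^ 2 : ℝ≥0) : ℝ) ≤
    16 * ((K ^ 2 * σ ^ 2 : ℝ≥0) : ℝ)
  rw [← Finset.sum_mul]
  refine mul_le_mul_of_nonneg_right ?_ (NNReal.coe_nonneg _)
  have hprod : ∑ p : Fin m × Fin n, (u p.1 * v p.2) ^ 2 = ‖u‖ ^ 2 * ‖v‖ ^ 2 := by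
    simp_rw [EuclideanSpace.real_norm_sq_eq, Finset.sum_mul_sum, Fintype.sum_prod_type, mul_pow]
  rw [hprod]
  have h1 : ‖u‖ ^ 2 ≤ 2 ^ 2 := by gcongr
  have h2 : ‖v‖ ^ 2 ≤ 2 ^ 2 := by gcongr
  calc _ ≤ (2 : ℝ) ^ 2 * 2 ^ 2 := by gcongr
    _ = 16 := by norm_num

open Module in
/-- The compression of a sub-Gaussian noise matrix to a `finrank E`-dimensional subspace of the
column space has operator norm `O(Kσ√(n + finrank E))` with exponentially high probability. -/
theorem IsSubgaussianNoise.exists_event_inner_le {Ω : Type*} [MeasurableSpace Ω] {μ : Measure Ω}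
    [IsProbabilityMeasure μ] {m n : ℕ} {G : Ω → Matrix (Fin m) (Fin n) ℝ} {σ K : ℝ≥0}
    (hG : IsSubgaussianNoise μ G σ K) (E : Submodule ℝ (EuclideanSpace ℝ (Fin m))) :
    ∃ A : Set Ω, MeasurableSet A ∧ 1 - Real.exp (-((n : ℝ) + finrank ℝ E)) ≤ μ.real A ∧
      ∀ ω ∈ A, ∀ u ∈ E, ∀ v : EuclideanSpace ℝ (Fin n), inner ℝ u ((G ω).toEuclideanLin v) ≤
        √(96 * (K ^ 2 * σ ^ 2) * (n + finrank ℝ E)) * (‖u‖ * ‖v‖) := by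
  classical
  -- `96 = 2 * 16 * 3`: tail exponent 3 per net pair, of which the union over `5 ^ (n + dim E)`
  -- pairs uses up 2, as `5 ≤ e²`.
  set t : ℝ := √(96 * (K ^ 2 * σ ^ 2) * (n + finrank ℝ E)) with ht
  obtain ⟨s, hscard, hsle, hsnet⟩ := exists_finset_net E
  obtain ⟨s', hscard', hsle', hsnet'⟩ := exists_finset_net (EuclideanSpace ℝ (Fin n))
  rw [finrank_euclideanSpace_fin] at hscard'
  let B : E × EuclideanSpace ℝ (Fin n) → Set Ω :=
    fun p => {ω | t < inner ℝ (p.1 : EuclideanSpace ℝ (Fin m)) ((G ω).toEuclideanLin p.2)}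
  let bad : Set Ω := ⋃ p ∈ s ×ˢ s', B p
  have hB : ∀ p ∈ s ×ˢ s', μ.real (B p) ≤ Real.exp (-(3 * ((n : ℝ) + finrank ℝ E))) := by
    intro p hp
    obtain ⟨hp1, hp2⟩ := Finset.mem_product.1 hp
    refine measureReal_lt_le_exp_of_hasSubgaussianMGF
      (hG.hasSubgaussianMGF_inner (hsle _ hp1) (hsle' _ hp2)) (Real.sqrt_nonneg _) ?_
    rw [ht, Real.sq_sqrt (by positivity)]
    push_cast
    exact le_of_eq (by ring)
  have h5 : (5 : ℝ) ≤ Real.exp 2 := by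
    have h1 := Real.exp_one_gt_d9
    have h2 : Real.exp 2 = Real.exp 1 * Real.exp 1 := by rw [← Real.exp_add]; norm_num
    rw [h2]; nlinarith
  have hbad : μ.real bad ≤ Real.exp (-((n : ℝ) + finrank ℝ E)) := by
    calc μ.real bad ≤ ∑ p ∈ s ×ˢ s', μ.real (B p) := measureReal_biUnion_finset_le _ _
      _ ≤ ∑ _p ∈ s ×ˢ s', Real.exp (-(3 * ((n : ℝ) + finrank ℝ E))) := Finset.sum_le_sum hB
      _ = (s.card * s'.card : ℝ) * Real.exp (-(3 * ((n : ℝ) + finrank ℝ E))) := by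
        rw [Finset.sum_const, Finset.card_product, nsmul_eq_mul, Nat.cast_mul]
      _ ≤ (Real.exp 2 ^ finrank ℝ E * Real.exp 2 ^ n) *
          Real.exp (-(3 * ((n : ℝ) + finrank ℝ E))) := by
        gcongr
        · exact (Nat.cast_le.2 hscard).trans (by push_cast; gcongr)
        · exact (Nat.cast_le.2 hscard').trans (by push_cast; gcongr)
      _ = Real.exp (-((n : ℝ) + finrank ℝ E)) := by
        rw [← Real.exp_nat_mul, ← Real.exp_nat_mul, ← Real.exp_add, ← Real.exp_add]
        congr 1; ring
  -- The entries are only a.e. measurable, so `bad` is replaced by its measurable hull.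
  refine ⟨(toMeasurable μ bad)ᶜ, (measurableSet_toMeasurable _ _).compl, ?_, ?_⟩
  · rw [probReal_compl_eq_one_sub (measurableSet_toMeasurable _ _), measureReal_def,
      measure_toMeasurable]
    exact sub_le_sub_left hbad 1
  · intro ω hω u hu v
    have hω' : ∀ c ∈ s, ∀ c' ∈ s',
        inner ℝ (c : EuclideanSpace ℝ (Fin m)) ((G ω).toEuclideanLin c') ≤ t := by
      intro c hc c' hc'
      by_contra! hlt
      exact hω (subset_toMeasurable _ _
        (Set.mem_biUnion (x := (c, c')) (Finset.mem_product.2 ⟨hc, hc'⟩) hlt))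
    let T : EuclideanSpace ℝ (Fin n) →L[ℝ] E :=
      E.orthogonalProjectionOnto.comp (LinearMap.toContinuousLinearMap (G ω).toEuclideanLin)
    have hT : ∀ (c : E) c', inner ℝ c (T c') =
        inner ℝ (c : EuclideanSpace ℝ (Fin m)) ((G ω).toEuclideanLin c') := fun c c' =>
      Submodule.inner_orthogonalProjectionOnto_eq_of_mem_left c _
    have hnorm := opNorm_le_of_forall_mem_net hsnet hsnet' T (Real.sqrt_nonneg _)
      fun c hc c' hc' => (hT c c').trans_le (hω' c hc c' hc')
    calc inner ℝ u ((G ω).toEuclideanLin v) = inner ℝ (⟨u, hu⟩ : E) (T v) := (hT ⟨u, hu⟩ v).symm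
      _ ≤ ‖u‖ * ‖T v‖ := real_inner_le_norm _ _
      _ ≤ ‖u‖ * (t * ‖v‖) := by gcongr; exact T.le_of_opNorm_le hnorm v
      _ = t * (‖u‖ * ‖v‖) := by ring

/-! ### Frobenius pairing and the basic inequality -/

theorem matFrobNorm_sq {m n : ℕ} (A : Matrix (Fin m) (Fin n) ℝ) :
    matFrobNorm A ^ 2 = ∑ i, ∑ j, A i j ^ 2 := by
  have h : matFrobNorm A = (∑ i, ∑ j, ‖A i j‖ ^ (2 : ℝ)) ^ (1 / 2 : ℝ) :=
    Matrix.frobenius_norm_def A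
  rw [h, ← Real.sqrt_eq_rpow, Real.sq_sqrt (by positivity)]
  simp

theorem matFrobNorm_nonneg {m n : ℕ} (A : Matrix (Fin m) (Fin n) ℝ) : 0 ≤ matFrobNorm A :=
  @norm_nonneg _ (Matrix.frobeniusNormedAddCommGroup).toNormedAddGroup.toSeminormedAddGroup A

theorem norm_toEuclideanLin_le_matOpNorm {m n : ℕ} (A : Matrix (Fin m) (Fin n) ℝ)
    (v : EuclideanSpace ℝ (Fin n)) : ‖A.toEuclideanLin v‖ ≤ matOpNorm A * ‖v‖ :=
  Matrix.l2_opNorm_mulVec A v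

theorem Matrix.rank_sub_le {m n : ℕ} (A B : Matrix (Fin m) (Fin n) ℝ) :
    (A - B).rank ≤ A.rank + B.rank := by
  have hle : LinearMap.range (A - B).mulVecLin ≤
      LinearMap.range A.mulVecLin ⊔ LinearMap.range B.mulVecLin := by
    rintro _ ⟨x, rfl⟩
    rw [Matrix.mulVecLin_apply, Matrix.sub_mulVec]
    exact Submodule.sub_mem _ (Submodule.mem_sup_left ⟨x, rfl⟩) (Submodule.mem_sup_right ⟨x, rfl⟩)
  exact (Submodule.finrank_mono hle).trans (Submodule.finrank_add_le_finrank_add_finrank _ _)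

theorem Matrix.rank_eq_finrank_range_toEuclideanLin {m n : ℕ} (A : Matrix (Fin m) (Fin n) ℝ) :
    A.rank = Module.finrank ℝ (LinearMap.range A.toEuclideanLin) := by
  rw [Matrix.toEuclideanLin, Matrix.toLpLin_eq_toLin]
  exact Matrix.rank_eq_finrank_range_toLin _ _ _

/-- The Frobenius inner product `⟪N, D⟫` evaluated along an orthonormal basis of the row space of
`D`. -/
theorem exists_orthonormal_sum_mul_eq {m n : ℕ} (D : Matrix (Fin m) (Fin n) ℝ) :
    ∃ v : Fin D.rank → EuclideanSpace ℝ (Fin n), (∀ k, ‖v k‖ = 1) ∧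
      ∀ N : Matrix (Fin m) (Fin n) ℝ, ∑ i, ∑ j, N i j * D i j =
        ∑ k, inner ℝ (D.toEuclideanLin (v k)) (N.toEuclideanLin (v k)) := by
  have hrank : Module.finrank ℝ (LinearMap.range D.transpose.toEuclideanLin) = D.rank := by
    rw [← Matrix.rank_eq_finrank_range_toEuclideanLin, Matrix.rank_transpose]
  let b := (stdOrthonormalBasis ℝ (LinearMap.range D.transpose.toEuclideanLin)).reindex
    (finCongr hrank)
  refine ⟨fun k => b k, fun k => b.orthonormal.1 k, fun N => ?_⟩
  -- The rows of `D` lie in the span of `b`, so `D = ∑ k, (D b_k) b_kᵀ`.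
  have hrow : ∀ i j, D i j = ∑ k, D.toEuclideanLin (b k) i * (b k : EuclideanSpace ℝ (Fin n)) j := by
    intro i j
    let w : LinearMap.range D.transpose.toEuclideanLin :=
      ⟨D.transpose.toEuclideanLin (EuclideanSpace.single i 1), ⟨_, rfl⟩⟩
    have hw : ∀ j, (w : EuclideanSpace ℝ (Fin n)) j = D i j := fun j => by
      simp [w]
    have h1 := congrArg (fun x : LinearMap.range D.transpose.toEuclideanLin =>
      (x : EuclideanSpace ℝ (Fin n)) j) (b.sum_repr w)
    simp only [hw] at h1
    rw [← h1]
    simp only [Submodule.coe_sum, Submodule.coe_smul, WithLp.ofLp_sum, Finset.sum_apply,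
      WithLp.ofLp_smul, Pi.smul_apply, smul_eq_mul]
    refine Finset.sum_congr rfl fun k _ => ?_
    congr 1
    rw [b.repr_apply_apply, Submodule.coe_inner, PiLp.inner_apply]
    simp only [hw, Matrix.ofLp_toLpLin, Matrix.toLin'_apply, Matrix.mulVec, dotProduct, RCLike.inner_apply,
      conj_trivial]
  calc ∑ i, ∑ j, N i j * D i j
      = ∑ i, ∑ j, ∑ k, N i j * (D.toEuclideanLin (b k) i * (b k : EuclideanSpace ℝ (Fin n)) j) := by
        refine Finset.sum_congr rfl fun i _ => Finset.sum_congr rfl fun j _ => ?_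
        rw [← Finset.mul_sum, ← hrow]
    _ = ∑ i, ∑ k, ∑ j, N i j * (D.toEuclideanLin (b k) i * (b k : EuclideanSpace ℝ (Fin n)) j) :=
        Finset.sum_congr rfl fun i _ => Finset.sum_comm
    _ = ∑ k, ∑ i, ∑ j, N i j * (D.toEuclideanLin (b k) i * (b k : EuclideanSpace ℝ (Fin n)) j) :=
        Finset.sum_comm
    _ = _ := by
        refine Finset.sum_congr rfl fun k _ => ?_
        rw [PiLp.inner_apply]
        refine Finset.sum_congr rfl fun i _ => ?_
        rw [RCLike.inner_apply, conj_trivial, Matrix.ofLp_toLpLin _ _ N, Matrix.toLin'_apply, Matrix.mulVec,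
          dotProduct, Finset.sum_mul]
        exact Finset.sum_congr rfl fun j _ => by ring

/-- Trace duality for the rank-restricted Frobenius norm: the pairing of `N` with a matrix `D` only
sees `N` compressed to the range of `D`. -/
theorem sum_mul_le_of_inner_le {m n : ℕ} {N D : Matrix (Fin m) (Fin n) ℝ} {s : ℝ} (hs : 0 ≤ s)
    (h : ∀ v w, inner ℝ (D.toEuclideanLin w) (N.toEuclideanLin v) ≤
      s * (‖D.toEuclideanLin w‖ * ‖v‖)) :
    ∑ i, ∑ j, N i j * D i j ≤ s * (√D.rank * matFrobNorm D) := by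
  obtain ⟨v, hv, hsum⟩ := exists_orthonormal_sum_mul_eq D
  have hD : matFrobNorm D ^ 2 = ∑ k, ‖D.toEuclideanLin (v k)‖ ^ 2 := by
    simp_rw [← real_inner_self_eq_norm_sq, ← hsum D, matFrobNorm_sq, sq]
  have hcs : ∑ k, ‖D.toEuclideanLin (v k)‖ ≤ √D.rank * matFrobNorm D := by
    refine le_of_sq_le_sq ?_ (mul_nonneg (Real.sqrt_nonneg _) (matFrobNorm_nonneg _))
    rw [mul_pow, Real.sq_sqrt (Nat.cast_nonneg _), hD]
    simpa using sq_sum_le_card_mul_sum_sq (s := Finset.univ)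
      (f := fun k => ‖D.toEuclideanLin (v k)‖)
  rw [hsum N]
  calc _ ≤ ∑ k, s * ‖D.toEuclideanLin (v k)‖ :=
        Finset.sum_le_sum fun k _ => by simpa [hv k] using h (v k) (v k)
    _ = s * ∑ k, ‖D.toEuclideanLin (v k)‖ := (Finset.mul_sum _ _ _).symm
    _ ≤ _ := by gcongr

/-- The basic inequality for a rank-constrained least squares solution. -/
theorem matFrobNorm_sub_sq_le {d₁ d d₂ r : ℕ} {Y : Matrix (Fin d₁) (Fin d₂) ℝ}
    {X' : Matrix (Fin d₁) (Fin d) ℝ} {M Mhat : Matrix (Fin d) (Fin d₂) ℝ} {s : ℝ} (hs : 0 ≤ s)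
    (hM : M.rank ≤ r) (hmin : IsRankConstrainedMinimizer r Y X' Mhat)
    (h : ∀ u ∈ LinearMap.range X'.toEuclideanLin, ∀ v,
      inner ℝ u ((Y - X' * M).toEuclideanLin v) ≤ s * (‖u‖ * ‖v‖)) :
    matFrobNorm (X' * M - X' * Mhat) ^ 2 ≤ 8 * r * s ^ 2 := by
  set D := X' * (Mhat - M) with hD
  have hrank : D.rank ≤ 2 * r := by
    have h1 : D.rank ≤ (Mhat - M).rank := Matrix.rank_mul_le_right X' (Mhat - M)
    have h2 := Matrix.rank_sub_le Mhat M
    have h3 := hmin.1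
    omega
  have hDeq : X' * Mhat = X' * M + D := by rw [hD, Matrix.mul_sub]; abel
  have hsq : matFrobNorm (Y - X' * Mhat) ^ 2 ≤ matFrobNorm (Y - X' * M) ^ 2 :=
    pow_le_pow_left₀ (matFrobNorm_nonneg _) (hmin.2 hM) 2
  have hpair : ∑ i, ∑ j, (Y - X' * M) i j * D i j ≤ s * (√D.rank * matFrobNorm D) := by
    refine sum_mul_le_of_inner_le hs fun v w => h _ ?_ v
    refine ⟨(Mhat - M).toEuclideanLin w, ?_⟩
    simp [hD, Matrix.toLpLin_apply]
  have hexp : matFrobNorm (Y - X' * Mhat) ^ 2 = matFrobNorm (Y - X' * M) ^ 2 -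
      2 * ∑ i, ∑ j, (Y - X' * M) i j * D i j + matFrobNorm D ^ 2 := by
    simp only [matFrobNorm_sq, hDeq, Finset.mul_sum, ← Finset.sum_sub_distrib,
      ← Finset.sum_add_distrib, Matrix.sub_apply, Matrix.add_apply]
    exact Finset.sum_congr rfl fun i _ => Finset.sum_congr rfl fun j _ => by ring
  have hnorm : matFrobNorm (X' * M - X' * Mhat) ^ 2 = matFrobNorm D ^ 2 := by
    simp [matFrobNorm_sq, hDeq]
  have hrank' : (D.rank : ℝ) ≤ 2 * r := by exact_mod_cast hrank
  have hq : √(D.rank : ℝ) ^ 2 = D.rank := Real.sq_sqrt (Nat.cast_nonneg _)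
  rw [hnorm]
  have h1 : matFrobNorm D ^ 2 ≤ 2 * (s * √D.rank) * matFrobNorm D := by nlinarith
  -- Completing the square avoids dividing by `‖D‖_F`, which may vanish.
  have h2 : matFrobNorm D ^ 2 ≤ 4 * (s * √D.rank) ^ 2 := by
    nlinarith [sq_nonneg (matFrobNorm D - 2 * (s * √D.rank))]
  calc _ ≤ 4 * (s * √D.rank) ^ 2 := h2
    _ = 4 * s ^ 2 * D.rank := by rw [mul_pow, hq]; ring
    _ ≤ 4 * s ^ 2 * (2 * r) := by gcongr
    _ = _ := by ring

/-! ### Existence of a minimizer -/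

theorem Matrix.isClosed_setOf_rank_le {m n : ℕ} (r : ℕ) :
    IsClosed {A : Matrix (Fin m) (Fin n) ℝ | A.rank ≤ r} := by
  let φ : Matrix (Fin m) (Fin n) ℝ →ₗ[ℝ] EuclideanSpace ℝ (Fin n) →L[ℝ] EuclideanSpace ℝ (Fin m) :=
    (Matrix.toEuclideanLin.trans LinearMap.toContinuousLinearMap).toLinearMap
  have hφ : Continuous φ := φ.continuous_of_finiteDimensional
  have hopen := (isOpen_setOfPred_nat_le_rank (𝕜 := ℝ) (E := EuclideanSpace ℝ (Fin n))
    (F := EuclideanSpace ℝ (Fin m)) (r + 1)).preimage hφ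
  rw [← isOpen_compl_iff]
  convert hopen using 1
  ext A
  have hrank : (LinearMap.rank (φ A : EuclideanSpace ℝ (Fin n) →ₗ[ℝ] EuclideanSpace ℝ (Fin m))) =
      (A.rank : Cardinal) := by
    rw [A.rank_eq_finrank_range_toEuclideanLin,
      Module.finrank_eq_rank]
    rfl
  simp only [Set.mem_compl_iff, Set.mem_ofPred_eq, not_le, Set.mem_preimage]
  rw [hrank, Nat.cast_le]
  omega

/-- Full column rank makes `Z ↦ X' * Z` a closed embedding, so the objective is coercive on the
closed set of matrices of rank at most `r`. -/
theorem exists_isRankConstrainedMinimizer {d₁ d d₂ : ℕ} (r : ℕ) (Y : Matrix (Fin d₁) (Fin d₂) ℝ)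
    {X' : Matrix (Fin d₁) (Fin d) ℝ} (hX' : X'.rank = d) :
    ∃ Mhat, IsRankConstrainedMinimizer r Y X' Mhat := by
  let := Matrix.frobeniusNormedAddCommGroup (m := Fin d₁) (n := Fin d₂) (α := ℝ)
  let := Matrix.frobeniusNormedSpace (m := Fin d₁) (n := Fin d₂) (R := ℝ) (α := ℝ)
  have hinj : Function.Injective X'.mulVecLin := by
    rw [← LinearMap.ker_eq_bot, ← Submodule.finrank_eq_zero]
    have h := X'.mulVecLin.finrank_range_add_finrank_ker
    rw [Module.finrank_fin_fun] at h
    have h' : Module.finrank ℝ (LinearMap.range X'.mulVecLin) = d := hX'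
    omega
  let φ : Matrix (Fin d) (Fin d₂) ℝ →ₗ[ℝ] Matrix (Fin d₁) (Fin d₂) ℝ :=
    { toFun := fun Z => X' * Z
      map_add' := Matrix.mul_add X'
      map_smul' := fun c Z => Matrix.mul_smul X' c Z }
  have hφ : LinearMap.ker φ = ⊥ := by
    refine LinearMap.ker_eq_bot.2 fun A B hAB => ?_
    ext i j
    have hcol : X'.mulVecLin (A.col j) = X'.mulVecLin (B.col j) := by
      ext i'
      exact congrFun (congrFun hAB i') j
    exact congrFun (hinj hcol) i
  have hemb := LinearMap.isClosedEmbedding_of_injective hφ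
  have : ProperSpace (Matrix (Fin d₁) (Fin d₂) ℝ) := FiniteDimensional.proper ℝ _
  have hcont : Continuous fun Z => ‖Y - φ Z‖ := by
    have := hemb.continuous
    fun_prop
  have htend : Filter.Tendsto (fun Z => ‖Y - φ Z‖)
      (Filter.cocompact (Matrix (Fin d) (Fin d₂) ℝ)) Filter.atTop :=
    (tendsto_norm_cocompact_atTop.comp
      (Homeomorph.subLeft Y).isClosedEmbedding.tendsto_cocompact).comp hemb.tendsto_cocompact
  obtain ⟨Z, hZ, hmin⟩ := hcont.continuousOn.exists_isMinOn' (Matrix.isClosed_setOf_rank_le r)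
    (x₀ := 0) (by simp) ((htend.mono_left inf_le_left).eventually_ge_atTop _)
  exact ⟨Z, hZ, hmin⟩

/-! ### The error bound -/

theorem theorem3p1 :
    ∃ C : ℝ, 0 < C ∧
      ∀ {Ω : Type*} [MeasurableSpace Ω] (μ : Measure Ω) [IsProbabilityMeasure μ]
        (d₁ d d₂ r : ℕ) (_ : 0 < d₁) (_ : 0 < d₂) (_ : d ≤ d₁)
        (X X' : Matrix (Fin d₁) (Fin d) ℝ) (_ : X.rank = d) (_ : X'.rank = d)
        (ε : ℝ) (σ K : ℝ≥0) (G : Ω → Matrix (Fin d₁) (Fin d₂) ℝ)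
        (_ : IsSubgaussianNoise μ G σ K),
        ∃ A : Set Ω, MeasurableSet A ∧
          1 - 2 * Real.exp (-((d₂ : ℝ) + (d : ℝ))) ≤ μ.real A ∧
          ∀ ω ∈ A, ∀ W M : Matrix (Fin d) (Fin d₂) ℝ, M.rank = r →
            matOpNorm (X * W - (X' * M + G ω)) ^ 2 ≤ ε * (d₁ : ℝ) →
            (∃ Mhat, IsRankConstrainedMinimizer r (X * W) X' Mhat) ∧
            ∀ Mhat, IsRankConstrainedMinimizer r (X * W) X' Mhat →
              matFrobNorm (X' * M - X' * Mhat) ^ 2 / ((d₁ : ℝ) * (d₂ : ℝ)) ≤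
                C * ((K : ℝ) ^ 2 * ((r : ℝ) * (((d₂ : ℝ) + (d : ℝ)) / ((d₁ : ℝ) * (d₂ : ℝ))) *
                  (σ : ℝ) ^ 2) + ε) := by
  -- `1536 = 8 * 2 * 96`; the `ε` term needs only 16.
  refine ⟨1536, by norm_num, ?_⟩
  intro Ω _ μ _ d₁ d d₂ r hd₁ hd₂ _ X X' _ hX' ε σ K G hG
  have hfin : Module.finrank ℝ (LinearMap.range X'.toEuclideanLin) = d := by
    rw [← Matrix.rank_eq_finrank_range_toEuclideanLin, hX']
  obtain ⟨A, hA, hprob, hev⟩ := hG.exists_event_inner_le (LinearMap.range X'.toEuclideanLin)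
  rw [hfin] at hprob hev
  refine ⟨A, hA, ?_, fun ω hω W M hM hop =>
    ⟨exists_isRankConstrainedMinimizer r _ hX', fun Mhat hmin => ?_⟩⟩
  · linarith [Real.exp_pos (-((d₂ : ℝ) + d))]
  set t : ℝ := √(96 * (K ^ 2 * σ ^ 2) * (d₂ + d)) with ht
  set q : ℝ := matOpNorm (X * W - (X' * M + G ω)) with hq
  have hq0 : 0 ≤ q := norm_nonneg (Matrix.toEuclideanLin.trans LinearMap.toContinuousLinearMap
    (X * W - (X' * M + G ω)))
  have ht2 : t ^ 2 = 96 * (K ^ 2 * σ ^ 2) * (d₂ + d) := Real.sq_sqrt (by positivity)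
  -- `ε d₁` dominates a square; the sign lets 16 grow to 1536.
  have hε : 0 ≤ ε := by
    by_contra! h
    have h1 : ε * (d₁ : ℝ) < 0 := mul_neg_of_neg_of_pos h (by exact_mod_cast hd₁)
    linarith [sq_nonneg q]
  have hmain : matFrobNorm (X' * M - X' * Mhat) ^ 2 ≤ 8 * r * (t + q) ^ 2 := by
    refine matFrobNorm_sub_sq_le (add_nonneg (Real.sqrt_nonneg _) hq0) hM.le hmin fun u hu v => ?_
    have hsplit : (X * W - X' * M).toEuclideanLin v =
        (G ω).toEuclideanLin v + (X * W - (X' * M + G ω)).toEuclideanLin v := by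
      rw [← LinearMap.add_apply, ← map_add]
      congr 2
      abel
    have hE : inner ℝ u ((X * W - (X' * M + G ω)).toEuclideanLin v) ≤ ‖u‖ * (q * ‖v‖) :=
      (real_inner_le_norm _ _).trans
        (mul_le_mul_of_nonneg_left (norm_toEuclideanLin_le_matOpNorm _ _) (norm_nonneg _))
    rw [hsplit, inner_add_right]
    linarith [hev ω hω u hu v]
  -- This turns the error `r ε / d₂` into `ε`.
  have hr : (r : ℝ) ≤ d₂ := by
    rw [← hM]
    exact_mod_cast M.rank_le_width
  have hd₁' : (0 : ℝ) < d₁ := by exact_mod_cast hd₁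
  have hd₂' : (0 : ℝ) < d₂ := by exact_mod_cast hd₂
  have htq : (t + q) ^ 2 ≤ 2 * (t ^ 2 + ε * d₁) := by nlinarith [sq_nonneg (t - q)]
  rw [div_le_iff₀ (by positivity)]
  calc matFrobNorm (X' * M - X' * Mhat) ^ 2 ≤ 8 * r * (2 * (t ^ 2 + ε * d₁)) :=
        hmain.trans (by gcongr)
    _ = 1536 * (K ^ 2 * (r * (d₂ + d)) * σ ^ 2) + 16 * (r * (ε * d₁)) := by rw [ht2]; ring
    _ ≤ 1536 * (K ^ 2 * (r * (d₂ + d)) * σ ^ 2) + 1536 * (d₂ * (ε * d₁)) := by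
        gcongr
        norm_num
    _ = 1536 * (K ^ 2 * (r * ((d₂ + d) / (d₁ * d₂)) * σ ^ 2) + ε) * (d₁ * d₂) := by
        field_simp
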